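/- **Setting.** Fix $\theta_0\in(0,1)$, $\alpha\in(0,1)$, a privacy budget $\varepsilon>0$ and a constant $\delta\in(0,1)$. For each sample size $n$ let $X_1,\dots,X_n\in\{0,1\}$ be i.i.d. with $\mathbb P(X_i=1)=\theta_0$, and let $Z$ be a real random variable, independent of the data, with mean zero and finite variance (for example unit variance), whose law does not depend on $n$. The released proportion of the additive privacy mechanism is $$\hat\pi=\bar\theta+Y,\qquad \bar\theta=\frac1n\sum_{i=1}^n\mathbf 1(X_i=1),\qquad Y=\frac{\Delta}{\varepsilon}Z,$$ where $\Delta=\sup|\bar\theta(\mathcal D)-\bar\theta(\mathcal D')|$ over databases $\mathcal D,\mathcal D'\in\{0,1\}^n$ that differ in exactly one entry (so $\Delta=1/n$). **FIMA.** Given $\hat\pi$, draw an independent copy $Y^*$ of $Y$, independent of the data and of $Z$, and put $\tilde\theta^*=\hat\pi-Y^*$. If $\tilde\theta^*>1$ set $\hat\theta=1-\delta$; if $\tilde\theta^*<0$ set $\hat\theta=\delta$. Otherwise $\hat\theta$ is obtained in one of the following ways. (a) Draw $U_1^*,\dots,U_n^*$ i.i.d. uniform on $[0,1]$ and $D$ from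 a fixed but arbitrary probability distribution on $[0,1]$, independently of each other and of everything else, and set, with $k=\lfloor n\tilde\theta^*\rfloor$, $$\hat\theta=U^*_{[k]}+D\,\bigl(U^*_{[k+1]}-U^*_{[k]}\bigr),$$ where $U^*_{[1]}\le\dots\le U^*_{[n]}$ are the order statistics, $U^*_{[0]}=\delta$ and $U^*_{[n+1]}=1-\delta$. (b) Draw $\hat\theta\sim\mathrm{Beta}\bigl(n\tilde\theta^*+\tfrac12,\;n-n\tilde\theta^*+\tfrac12\bigr)$. Let $\hat\theta_\alpha=\inf\{v\in\mathbb R:\mathbb P(\hat\theta\le v\mid\hat\pi)\ge\alpha\}$ be the $\alpha$-quantile of the distribution of $\hat\theta$ conditional on $\hat\pi$. **Theorem.** Under (a), for every choice of the distribution of $D$, and likewise under (b), $$\mathbb P(\theta_0\le\hat\theta_\alpha)\longrightarrow\alpha\qquad(n\to\infty).$$ -/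

import Mathlib

open MeasureTheory ProbabilityTheory Filter Topology Set

noncomputable section

namespace FIMA

/-- A database of size `n`: each individual belongs to class `0` or to class `1`. -/
abbrev Database (n : ℕ) : Type := Fin n → Fin 2

/-- The sample proportion `(1/n) ∑ᵢ 𝟙(xᵢ = 1)`. -/
def sampleProp {n : ℕ} (x : Database n) : ℝ :=
  (1 / (n : ℝ)) * ∑ i, if x i = 1 then (1 : ℝ) else 0

/-- The sensitivity of the sample proportion: the supremum of its change over all pairs of
databases of size `n` that differ in exactly one entry. -/
def sensitivity (n : ℕ) : ℝ :=
  sSup {r : ℝ | ∃ x x' : Database n, hammingDist x x' = 1 ∧ r = |sampleProp x - sampleProp x'|}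

/-- The privacy noise `Y = (Δ / ε) Z`, with `Δ` the sensitivity. -/
def privacyNoise (n : ℕ) (ε z : ℝ) : ℝ := sensitivity n / ε * z

/-- The released proportion `π̂ = θ̄ + (Δ / ε) Z` of the additive privacy mechanism. -/
def dpProp {n : ℕ} (ε : ℝ) (x : Database n) (z : ℝ) : ℝ := sampleProp x + privacyNoise n ε z

/-- The `k`-th smallest value `U_[k]` of `u₁, …, uₙ` for `1 ≤ k ≤ n`, with the end-point
conventions `U_[0] = δ` and `U_[k] = 1 - δ` for `k > n`. -/
def orderStat {n : ℕ} (δ : ℝ) (u : Fin n → ℝ) (k : ℕ) : ℝ :=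
  if k = 0 then δ else if h : k - 1 < n then u (Tuple.sort u ⟨k - 1, h⟩) else 1 - δ

/-- One draw `θ̂` of the fiducial matching algorithm with input `p` (the released proportion),
as a function of the fresh privacy noise variable `z`, the fresh uniform sample `u`, and the
interpolation variable `d`. -/
def draw (n : ℕ) (ε δ p z : ℝ) (u : Fin n → ℝ) (d : ℝ) : ℝ :=
  let t := p - privacyNoise n ε z
  if 1 < t then 1 - δ
  else if t < 0 then δ
  else orderStat δ u ⌊n * t⌋₊ +
    d * (orderStat δ u (⌊n * t⌋₊ + 1) - orderStat δ u ⌊n * t⌋₊)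

/-- The distribution of `θ̂` conditional on `π̂ = p`, when `Z* ~ ν`, `U₁*, …, Uₙ*` iid uniform on
`[0, 1]` and `D ~ g` are drawn independently of each other and of the data. -/
def drawLaw (n : ℕ) (ε δ : ℝ) (ν g : Measure ℝ) (p : ℝ) : Measure ℝ :=
  ((ν.prod (Measure.pi fun _ : Fin n => volume.restrict (Icc (0 : ℝ) 1))).prod g).map
    fun w => draw n ε δ p w.1.1 w.1.2 w.2

/-- The Beta version of the second step: the distribution of `θ̂` given `θ̃* = t`. Outside of
`[0, 1]` the value is set to `1 - δ` or `δ`, as in the algorithm. -/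
def betaStep (n : ℕ) (δ t : ℝ) : Measure ℝ :=
  if 1 < t then Measure.dirac (1 - δ)
  else if t < 0 then Measure.dirac δ
  else betaMeasure (n * t + 1 / 2) (n - n * t + 1 / 2)

/-- The distribution of `θ̂` conditional on `π̂ = p` in the Beta version: `Z* ~ ν` is drawn
independently of the data, `θ̃* = p - Y*`, and then `θ̂` is drawn from `betaStep n δ θ̃*`. -/
def betaLaw (n : ℕ) (ε δ : ℝ) (ν : Measure ℝ) (p : ℝ) : Measure ℝ :=
  ν.bind fun z => betaStep n δ (p - privacyNoise n ε z)

/-- The `α`-quantile `inf {v : μ((-∞, v]) ≥ α}`. -/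
def quantile (μ : Measure ℝ) (α : ℝ) : ℝ := sInf {v : ℝ | α ≤ μ.real (Iic v)}

end FIMA

end

/-! Let S be the number of ones in the data, T(k) = P(Bin(n, θ₀) ≥ k) (`binomTail`), and η(M) =
ν(|z| > εM). Since Δ = 1/n, n θ̃* = S + (Z - Z*)/ε, so the privacy noise displaces the count by a
quantity whose law is free of n. If |Z| and |Z*| are at most εM, the displacement is at most 2M, and
θ̂ given π̂ lies stochastically between the order statistics of ranks S - 2M and S + 2M + 1. The
k-th of n uniform order statistics has distribution function T(k) at θ₀, hence the conditional
distribution function of θ̂ at θ₀ lies between T(S + 2M + 1) - η(M) and T(S - 2M) + η(M).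

The atoms of Bin(n, θ₀) are bounded by some b(n) → 0 uniformly in k
(`exists_tendsto_zero_binomMass_le`), so replacing both bounds by T(S) costs O(M b(n)). As S is
itself binomial, T(S) is uniform up to one atom, and θ₀ ≤ θ̂_α amounts to T(S) ≤ α up to these
errors. `abs_coverage_sub_le` gives a coverage error of at most 2η(M) + (6M + 6) b(n); fix M large,
then let n → ∞.

Version (b) obeys the same two bounds: Beta(k, n + 1 - k) is the law of the k-th order statistic,
and Beta(a, n + 1 - a) increases stochastically with a. -/

/-! ### Binomial tails and uniform smallness of binomial atoms. -/

/-- The mass `C(n, k) θ^k (1 - θ)^(n - k)` of the binomial distribution. -/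
noncomputable def binomMass (θ : ℝ) (n k : ℕ) : ℝ := n.choose k * θ ^ k * (1 - θ) ^ (n - k)

/-- The upper tail of the binomial distribution. -/
noncomputable def binomTail (θ : ℝ) (n k : ℕ) : ℝ := ∑ j ∈ Finset.Icc k n, binomMass θ n j

lemma binomMass_nonneg {θ : ℝ} (hθ : θ ∈ Icc (0 : ℝ) 1) (n k : ℕ) : 0 ≤ binomMass θ n k := by
  have := sub_nonneg.2 hθ.2
  have := hθ.1
  unfold binomMass; positivity

lemma binomTail_zero (θ : ℝ) (n : ℕ) : binomTail θ n 0 = 1 := by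
  have h := add_pow θ (1 - θ) n
  rw [add_sub_cancel, one_pow] at h
  rw [h, binomTail]
  refine Finset.sum_congr (by ext; simp) fun k _ => ?_
  rw [binomMass]; ring

lemma binomTail_of_lt (θ : ℝ) {n k : ℕ} (h : n < k) : binomTail θ n k = 0 := by
  simp [binomTail, Finset.Icc_eq_empty_of_lt h]

lemma binomTail_eq_add (θ : ℝ) (n k : ℕ) :
    binomTail θ n k = binomMass θ n k + binomTail θ n (k + 1) := by
  rcases le_or_gt k n with h | h
  · have : Finset.Icc k n = insert k (Finset.Icc (k + 1) n) := by
      ext; simp; omega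
    rw [binomTail, binomTail, this, Finset.sum_insert (by simp)]
  · rw [binomTail_of_lt θ h, binomTail_of_lt θ (by omega), binomMass,
      Nat.choose_eq_zero_of_lt h]
    simp

lemma binomTail_antitone {θ : ℝ} (hθ : θ ∈ Icc (0 : ℝ) 1) (n : ℕ) :
    Antitone (binomTail θ n) :=
  antitone_nat_of_succ_le fun k => by
    have := binomMass_nonneg hθ n k
    rw [binomTail_eq_add θ n k]; linarith

lemma binomTail_le_add {θ b : ℝ} {n : ℕ} (hb : ∀ k, binomMass θ n k ≤ b) (k m : ℕ) :
    binomTail θ n k ≤ binomTail θ n (k + m) + m * b := by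
  induction m with
  | zero => simp
  | succ m ih =>
    have := binomTail_eq_add θ n (k + m)
    have := hb (k + m)
    rw [← add_assoc]; push_cast; linarith

lemma integral_exp_int_mul (m : ℤ) :
    ∫ t in (0 : ℝ)..2 * Real.pi, Complex.exp (m * Complex.I * t) =
      if m = 0 then (2 * Real.pi : ℂ) else 0 := by
  split_ifs with h
  · simp [h]
  · rw [integral_exp_mul_complex (by simp [h])]
    have : (m : ℂ) * Complex.I * ((2 * Real.pi : ℝ) : ℂ) = m * (2 * Real.pi * Complex.I) := by
      push_cast; ring
    rw [this, Complex.exp_int_mul_two_pi_mul_I]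
    simp

/-- Fourier inversion: expand the n-th power of the Bernoulli characteristic function; orthogonality
of the exponentials keeps only the k-th term. -/
lemma integral_bernoulli_charFun_pow (θ : ℝ) (n k : ℕ) :
    ∫ t in (0 : ℝ)..2 * Real.pi,
      (θ * Complex.exp (Complex.I * t) + (1 - θ)) ^ n * Complex.exp (-k * Complex.I * t) =
      2 * Real.pi * binomMass θ n k := by
  have h : ∀ t : ℝ,
      (θ * Complex.exp (Complex.I * t) + (1 - θ)) ^ n * Complex.exp (-k * Complex.I * t) =
      ∑ m ∈ Finset.range (n + 1), (binomMass θ n m : ℂ) *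
        Complex.exp (((m - k : ℤ) : ℂ) * Complex.I * t) := by
    intro t
    rw [add_pow, Finset.sum_mul]
    refine Finset.sum_congr rfl fun m _ => ?_
    have : ((m - k : ℤ) : ℂ) * Complex.I * t = m * (Complex.I * t) + -k * Complex.I * t := by
      push_cast; ring
    rw [this, Complex.exp_add, Complex.exp_nat_mul, binomMass, mul_pow]
    push_cast; ring
  simp_rw [h]
  rw [intervalIntegral.integral_finsetSum
    fun m _ => Continuous.intervalIntegrable (by fun_prop) _ _]
  simp_rw [intervalIntegral.integral_const_mul, integral_exp_int_mul, sub_eq_zero, Nat.cast_inj]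
  rw [Finset.sum_eq_single k]
  · simp [mul_comm]
  · intro m _ hm; simp [hm]
  · intro hk
    simp [binomMass, Nat.choose_eq_zero_of_lt (show n < k by simpa using hk)]

lemma norm_bernoulli_charFun_sq (θ t : ℝ) :
    ‖(θ * Complex.exp (Complex.I * t) + (1 - θ) : ℂ)‖ ^ 2 =
      1 - 2 * θ * (1 - θ) * (1 - Real.cos t) := by
  rw [← Complex.normSq_eq_norm_sq, mul_comm Complex.I, Complex.exp_mul_I,
    ← Complex.ofReal_cos, ← Complex.ofReal_sin, Complex.normSq_apply]
  simp only [Complex.add_re, Complex.mul_re, Complex.add_im, Complex.mul_im, Complex.ofReal_re,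
    Complex.ofReal_im, Complex.sub_re, Complex.sub_im, Complex.one_re, Complex.one_im, Complex.I_re,
    Complex.I_im]
  ring_nf
  nlinarith [Real.sin_sq_add_cos_sq t]

/-- By Fourier inversion every atom is at most the mean of |f|^n over a period, a bound free of k.
It vanishes by dominated convergence, because |f| < 1 away from the two endpoints. -/
lemma exists_tendsto_zero_binomMass_le {θ : ℝ} (hθ : θ ∈ Ioo (0 : ℝ) 1) :
    ∃ b : ℕ → ℝ, Tendsto b atTop (𝓝 0) ∧ ∀ n k, binomMass θ n k ≤ b n := by
  have hpi := Real.pi_pos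
  have hpos : 0 < 2 * θ * (1 - θ) := by
    have := sub_pos.2 hθ.2
    have := hθ.1
    positivity
  set f : ℝ → ℂ := fun t => θ * Complex.exp (Complex.I * t) + (1 - θ) with hf
  have hfc : Continuous f := by fun_prop
  have hf1 : ∀ t, ‖f t‖ ≤ 1 := fun t => by
    have := norm_bernoulli_charFun_sq θ t
    have h2 : 0 ≤ 2 * θ * (1 - θ) * (1 - Real.cos t) :=
      mul_nonneg hpos.le (sub_nonneg.2 (Real.cos_le_one t))
    exact (sq_le_one_iff₀ (norm_nonneg _)).1 (by rw [this]; linarith)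
  have hlt : ∀ t ∈ Ioo (0 : ℝ) (2 * Real.pi), ‖f t‖ < 1 := fun t ht => by
    have := norm_bernoulli_charFun_sq θ t
    have hc : Real.cos t < 1 := by
      refine lt_of_le_of_ne (Real.cos_le_one t) fun h => ?_
      have := (Real.cos_eq_one_iff_of_lt_of_lt (by linarith [ht.1]) ht.2).1 h
      exact ht.1.ne' this
    have h2 : 0 < 2 * θ * (1 - θ) * (1 - Real.cos t) := mul_pos hpos (sub_pos.2 hc)
    exact (sq_lt_one_iff₀ (norm_nonneg _)).1 (by rw [this]; linarith)
  refine ⟨fun n => (2 * Real.pi)⁻¹ * ∫ t in (0 : ℝ)..2 * Real.pi, ‖f t‖ ^ n, ?_, fun n k => ?_⟩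
  · have : Tendsto (fun n : ℕ => ∫ t in (0 : ℝ)..2 * Real.pi, ‖f t‖ ^ n) atTop
        (𝓝 (∫ _ in (0 : ℝ)..2 * Real.pi, (0 : ℝ))) := by
      refine intervalIntegral.tendsto_integral_filter_of_dominated_convergence (fun _ => 1)
        (Eventually.of_forall fun n => (by fun_prop : Continuous _).aestronglyMeasurable)
        (Eventually.of_forall fun n => Eventually.of_forall fun t _ => ?_) (by simp) ?_
      · rw [norm_pow, norm_norm]; exact pow_le_one₀ (norm_nonneg _) (hf1 t)
      · have : ∀ᵐ t : ℝ, t ≠ 2 * Real.pi := by simp [ae_iff]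
        filter_upwards [this] with t ht hmem
        rw [uIoc_of_le (by positivity)] at hmem
        exact tendsto_pow_atTop_nhds_zero_of_lt_one (norm_nonneg _)
          (hlt t ⟨hmem.1, lt_of_le_of_ne hmem.2 ht⟩)
    simpa using this.const_mul (2 * Real.pi)⁻¹
  · beta_reduce
    have h := congrArg norm (integral_bernoulli_charFun_pow θ n k)
    have h2 := intervalIntegral.norm_integral_le_integral_norm (μ := volume)
      (f := fun t : ℝ => f t ^ n * Complex.exp (-k * Complex.I * t))
      (show (0 : ℝ) ≤ 2 * Real.pi by positivity)
    have h3 : ∀ t : ℝ, ‖f t ^ n * Complex.exp (-k * Complex.I * t)‖ = ‖f t‖ ^ n := fun t => by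
      rw [norm_mul, norm_pow, Complex.norm_exp]; simp
    simp_rw [h3] at h2
    rw [h] at h2
    simp only [norm_mul, Complex.norm_real, Complex.norm_ofNat, Real.norm_eq_abs, abs_of_pos hpi,
      abs_of_nonneg (binomMass_nonneg (Ioo_subset_Icc_self hθ) n k)] at h2
    rw [inv_mul_eq_div, le_div_iff₀ (by positivity)]
    linarith

/-! ### Counts of successes in independent trials are binomial. -/

section Count

open scoped Classical in
/-- The number of entries of a tuple that lie in a given set. -/
noncomputable def countMem {β : Type*} {n : ℕ} (B : Set β) (x : Fin n → β) : ℕ :=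
  (Finset.univ.filter (fun i => x i ∈ B)).card

lemma countMem_le {β : Type*} {n : ℕ} (B : Set β) (x : Fin n → β) : countMem B x ≤ n := by
  classical
  exact (Finset.card_le_univ _).trans_eq (Fintype.card_fin n)

variable {Ω β : Type*} [MeasurableSpace Ω] [MeasurableSpace β] {P : Measure Ω}
  [IsProbabilityMeasure P] {n : ℕ} {X : Fin n → Ω → β} {B : Set β} {θ : ℝ}

open scoped Classical in
lemma measureReal_filter_eq (hX : ∀ i, Measurable (X i)) (hI : iIndepFun X P)
    (hB : MeasurableSet B) (hθ : ∀ i, P.real (X i ⁻¹' B) = θ) (s : Finset (Fin n)) :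
    P.real {ω | Finset.univ.filter (fun i => X i ω ∈ B) = s} =
      θ ^ s.card * (1 - θ) ^ (n - s.card) := by
  have h1 : {ω | Finset.univ.filter (fun i => X i ω ∈ B) = s} =
      ⋂ i, X i ⁻¹' (if i ∈ s then B else Bᶜ) := by
    ext ω
    simp only [mem_ofPred_eq, Finset.ext_iff, Finset.mem_filter, Finset.mem_univ, true_and,
      mem_iInter, mem_preimage]
    refine forall_congr' fun i => ?_
    split_ifs with h <;> simp [h]
  have hm : ∀ i, MeasurableSet (if i ∈ s then B else Bᶜ) := fun i => by
    split_ifs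
    exacts [hB, hB.compl]
  rw [h1, measureReal_def, hI.meas_iInter fun i => ⟨_, hm i, rfl⟩, ENNReal.toReal_prod]
  have h2 : ∀ i, (P (X i ⁻¹' (if i ∈ s then B else Bᶜ))).toReal =
      if i ∈ s then θ else 1 - θ := fun i => by
    split_ifs
    · exact hθ i
    · rw [← hθ i, ← probReal_compl_eq_one_sub ((hX i) hB)]; rfl
  simp_rw [h2]
  rw [Finset.prod_ite, Finset.prod_const, Finset.prod_const]
  congr 2
  · congr 1; ext; simp
  · rw [show Finset.univ.filter (fun i => i ∉ s) = sᶜ by ext; simp, Finset.card_compl,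
      Fintype.card_fin]

open scoped Classical in
lemma measureReal_countMem_eq (hX : ∀ i, Measurable (X i)) (hI : iIndepFun X P)
    (hB : MeasurableSet B) (hθ : ∀ i, P.real (X i ⁻¹' B) = θ) (k : ℕ) :
    P.real {ω | countMem B (fun i => X i ω) = k} = binomMass θ n k := by
  have hm : ∀ s : Finset (Fin n),
      MeasurableSet {ω | Finset.univ.filter (fun i => X i ω ∈ B) = s} := fun s => by
    simp only [Finset.ext_iff, Finset.mem_filter, Finset.mem_univ, true_and]
    rw [ofPred_forall]
    exact MeasurableSet.iInter fun i =>
      MeasurableSet.iff ((hX i) hB) (MeasurableSet.const _)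
  have h : {ω | countMem B (fun i => X i ω) = k} =
      ⋃ s ∈ Finset.powersetCard k (Finset.univ : Finset (Fin n)),
        {ω | Finset.univ.filter (fun i => X i ω ∈ B) = s} := by
    ext ω
    simp [Finset.mem_powersetCard, countMem]
  rw [h, measureReal_biUnion_finset _ fun s _ => hm s]
  · rw [Finset.sum_congr rfl (g := fun _ => θ ^ k * (1 - θ) ^ (n - k)), Finset.sum_const,
      Finset.card_powersetCard, Finset.card_univ, Fintype.card_fin, nsmul_eq_mul, binomMass,
      mul_assoc]
    intro s hs
    rw [measureReal_filter_eq hX hI hB hθ, (Finset.mem_powersetCard.1 hs).2]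
  · intro s _ t _ hst
    refine Set.disjoint_left.2 fun ω h1 h2 => hst ?_
    exact Eq.trans (Eq.symm h1) h2

open scoped Classical in
lemma measurable_countMem (hB : MeasurableSet B) :
    Measurable (countMem B : (Fin n → β) → ℕ) := by
  have : Measurable fun x : Fin n → β => ∑ i, B.indicator (fun _ => (1 : ℕ)) (x i) :=
    Finset.measurable_sum _ fun i _ =>
      (measurable_const.indicator hB).comp (measurable_pi_apply i)
  convert this using 1
  ext x
  simp only [countMem, Finset.card_filter, Set.indicator_apply]

lemma measurable_countMem_comp (hX : ∀ i, Measurable (X i)) (hB : MeasurableSet B) :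
    Measurable fun ω => countMem B fun i => X i ω :=
  (measurable_countMem hB).comp (measurable_pi_lambda _ hX)

lemma measureReal_le_countMem (hX : ∀ i, Measurable (X i)) (hI : iIndepFun X P)
    (hB : MeasurableSet B) (hθ : ∀ i, P.real (X i ⁻¹' B) = θ) (k : ℕ) :
    P.real {ω | k ≤ countMem B fun i => X i ω} = binomTail θ n k := by
  have h : {ω | k ≤ countMem B fun i => X i ω} =
      ⋃ j ∈ Finset.Icc k n, {ω | countMem B (fun i => X i ω) = j} := by
    ext ω
    simp [countMem_le]
  rw [h, measureReal_biUnion_finset]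
  · exact Finset.sum_congr rfl fun j _ => measureReal_countMem_eq hX hI hB hθ j
  · intro s _ t _ hst
    refine Set.disjoint_left.2 fun ω h1 h2 => hst ?_
    exact Eq.trans (Eq.symm h1) h2
  · exact fun j _ => measurable_countMem_comp hX hB (measurableSet_singleton j)

end Count

/-! ### Comparing a point with a quantile through the distribution function. -/

section Quantile

variable {μ : Measure ℝ} [IsProbabilityMeasure μ] {α θ : ℝ}

lemma nonempty_quantile_set (hα : α < 1) : {v : ℝ | α ≤ μ.real (Iic v)}.Nonempty := by
  have h := tendsto_cdf_atTop μ
  obtain ⟨v, hv⟩ := (h.eventually (lt_mem_nhds hα)).exists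
  exact ⟨v, by rw [cdf_eq_real] at hv; exact hv.le⟩

lemma bddBelow_quantile_set (hα : 0 < α) : BddBelow {v : ℝ | α ≤ μ.real (Iic v)} := by
  have h := tendsto_cdf_atBot μ
  obtain ⟨v, hv⟩ := (h.eventually (gt_mem_nhds hα)).exists
  rw [cdf_eq_real] at hv
  refine ⟨v, fun w (hw : α ≤ _) => le_of_not_gt fun hwv => ?_⟩
  have : μ.real (Iic w) ≤ μ.real (Iic v) := measureReal_mono (Iic_subset_Iic.2 hwv.le)
  linarith

lemma le_quantile_of_lt (hα : α < 1) (h : μ.real (Iic θ) < α) : θ ≤ FIMA.quantile μ α := by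
  refine le_csInf (nonempty_quantile_set hα) fun v (hv : α ≤ _) => le_of_not_gt fun hvθ => ?_
  have : μ.real (Iic v) ≤ μ.real (Iic θ) := measureReal_mono (Iic_subset_Iic.2 hvθ.le)
  linarith

/-- The distribution function is below α strictly to the left of the quantile; passing to the left
limit controls only the open half-line, since μ may have an atom at θ. -/
lemma measureReal_Iio_le_of_le_quantile (hα : 0 < α) (h : θ ≤ FIMA.quantile μ α) :
    μ.real (Iio θ) ≤ α := by
  have hlt : ∀ v < θ, μ.real (Iic v) < α := fun v hv => by
    by_contra! hc
    exact absurd (csInf_le (bddBelow_quantile_set hα) hc) (not_le.2 (hv.trans_le h))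
  obtain ⟨u, hu, hlim⟩ : ∃ u : ℕ → ℝ, (∀ k, u k < θ) ∧ Tendsto u atTop (𝓝 θ) := by
    obtain ⟨u, -, h1, h2⟩ := exists_seq_strictMono_tendsto θ
    exact ⟨u, h1, h2⟩
  -- Tail intersections form an increasing family, so continuity from below applies without
  -- monotonicity of `u`.
  have hU : Iio θ ⊆ ⋃ k, ⋂ j ≥ k, Iic (u j) := fun x hx => by
    obtain ⟨k, hk⟩ := eventually_atTop.1 (hlim.eventually (lt_mem_nhds hx))
    exact mem_iUnion.2 ⟨k, mem_iInter₂.2 fun j hj => (hk j hj).le⟩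
  have hmono : Monotone fun k => ⋂ j ≥ k, Iic (u j) := fun k l hkl x hx =>
    mem_iInter₂.2 fun j hj => mem_iInter₂.1 hx j (hkl.trans hj)
  have ht := tendsto_measure_iUnion_atTop (μ := μ) hmono
  have ht' := (ENNReal.tendsto_toReal (measure_ne_top μ _)).comp ht
  refine (measureReal_mono hU).trans (le_of_tendsto' ht' fun k => ?_)
  exact (measureReal_mono (iInter₂_subset k le_rfl)).trans (hlt _ (hu k)).le

end Quantile

/-! ### Near-uniformity of T(S) and the coverage bound. -/

section TailValue

variable {Ω : Type*} [MeasurableSpace Ω] {P : Measure Ω} [IsProbabilityMeasure P] {θ : ℝ} {n : ℕ}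
  {S : Ω → ℕ}

/-- The upper tail probability evaluated at the variable itself is stochastically larger than the
uniform distribution. -/
lemma measureReal_binomTail_le (hS : ∀ k, P.real {ω | k ≤ S ω} = binomTail θ n k) {c : ℝ} (hc : 0 ≤ c) :
    P.real {ω | binomTail θ n (S ω) ≤ c} ≤ c := by
  have hex : ∃ k, binomTail θ n k ≤ c := ⟨n + 1, by rwa [binomTail_of_lt θ (by omega)]⟩
  classical
  -- With k the least index whose tail is at most c, the event forces S ≥ k, which has probability
  -- T(k) ≤ c.
  refine (measureReal_mono (s₂ := {ω | Nat.find hex ≤ S ω}) fun ω hω => ?_).trans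
    ((hS _).le.trans (Nat.find_spec hex))
  exact Nat.find_min' hex hω

lemma sub_le_measureReal_binomTail_lt (hθ : θ ∈ Icc (0 : ℝ) 1)
    (hS : ∀ k, P.real {ω | k ≤ S ω} = binomTail θ n k) {b : ℝ}
    (hb : ∀ k, binomMass θ n k ≤ b) {c : ℝ} (hc : c ≤ 1) :
    c - b ≤ P.real {ω | binomTail θ n (S ω) < c} := by
  rcases le_or_gt c 0 with h0 | h0
  · have := (binomMass_nonneg hθ n 0).trans (hb 0)
    linarith [measureReal_nonneg (μ := P) (s := {ω | binomTail θ n (S ω) < c})]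
  have hex : ∃ k, binomTail θ n k < c := ⟨n + 1, by rwa [binomTail_of_lt θ (by omega)]⟩
  classical
  -- The least index with tail below c is not 0 because T(0) = 1 ≥ c. Its predecessor k has T(k) ≥
  -- c, so T(k + 1) falls short of c by at most one atom.
  obtain ⟨k, hk⟩ : ∃ k, Nat.find hex = k + 1 := Nat.exists_eq_succ_of_ne_zero fun h => by
    have := Nat.find_spec hex
    rw [h, binomTail_zero] at this
    linarith
  have h1 : c ≤ binomTail θ n k := not_lt.1 (Nat.find_min hex (by omega))
  have h2 : binomTail θ n (k + 1) ≤ P.real {ω | binomTail θ n (S ω) < c} := by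
    rw [← hS, ← hk]
    refine measureReal_mono fun ω hω => ?_
    exact (binomTail_antitone hθ n hω).trans_lt (Nat.find_spec hex)
  have := binomTail_eq_add θ n k
  have := hb k
  linarith

/-- The constant: excluding extreme counts costs 2M + 2 atoms at each end. Moving the rank back to
S, together with the non-uniformity of T(S), costs at most 2M + 1 more. One η comes from the
sandwich and one from `A`. -/
lemma abs_coverage_sub_le (hθ : θ ∈ Icc (0 : ℝ) 1)
    (hSm : ∀ k, MeasurableSet {ω | k ≤ S ω})
    (hS : ∀ k, P.real {ω | k ≤ S ω} = binomTail θ n k) {b : ℝ}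
    (hb : ∀ k, binomMass θ n k ≤ b) {α : ℝ} (hα : α ∈ Ioo (0 : ℝ) 1) {M : ℕ} (hM : 2 * M + 1 ≤ n)
    {A : Set Ω} {η : ℝ} (hA : P.real A ≤ η) (q : Ω → Measure ℝ) [∀ ω, IsProbabilityMeasure (q ω)]
    (hup : ∀ ω, ω ∉ A → 2 * M + 2 ≤ S ω → S ω + 2 * M + 2 ≤ n →
      (q ω).real (Iic θ) ≤ binomTail θ n (S ω - 2 * M) + η)
    (hlo : ∀ ω, ω ∉ A → 2 * M + 2 ≤ S ω → S ω + 2 * M + 2 ≤ n →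
      binomTail θ n (S ω + 2 * M + 1) ≤ (q ω).real (Iio θ) + η) :
    |P.real {ω | θ ≤ FIMA.quantile (q ω) α} - α| ≤ 2 * η + (6 * M + 6) * b := by
  have hb0 : 0 ≤ b := (binomMass_nonneg hθ n 0).trans (hb 0)
  have hη : 0 ≤ η := measureReal_nonneg.trans hA
  set G : Set Ω := A ∪ {ω | 2 * M + 2 ≤ S ω}ᶜ ∪ {ω | n - 2 * M - 1 ≤ S ω} with hG
  have hGP : P.real G ≤ η + (4 * M + 4) * b := by
    have h1 : P.real {ω | 2 * M + 2 ≤ S ω}ᶜ ≤ (2 * M + 2) * b := by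
      rw [probReal_compl_eq_one_sub (hSm _), hS]
      have := binomTail_le_add hb 0 (2 * M + 2)
      rw [binomTail_zero, zero_add] at this
      push_cast at this; linarith
    have h2 : P.real {ω | n - 2 * M - 1 ≤ S ω} ≤ (2 * M + 2) * b := by
      rw [hS]
      have := binomTail_le_add hb (n - 2 * M - 1) (2 * M + 2)
      rw [binomTail_of_lt θ (show n < n - 2 * M - 1 + (2 * M + 2) by omega), zero_add] at this
      push_cast at this; linarith
    have h3 := measureReal_union_le (μ := P) (A ∪ {ω | 2 * M + 2 ≤ S ω}ᶜ) {ω | n - 2 * M - 1 ≤ S ω}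
    have h4 := measureReal_union_le (μ := P) A {ω | 2 * M + 2 ≤ S ω}ᶜ
    linarith
  have hnG : ∀ ω, ω ∉ G → ω ∉ A ∧ 2 * M + 2 ≤ S ω ∧ S ω + 2 * M + 2 ≤ n := fun ω hω => by
    simp only [hG, mem_union, mem_compl_iff, mem_ofPred_eq, not_or, not_le] at hω
    exact ⟨hω.1.1, by omega, by omega⟩
  rw [abs_sub_le_iff]
  constructor
  · have hsub : {ω | θ ≤ FIMA.quantile (q ω) α} ⊆
        {ω | binomTail θ n (S ω) ≤ α + η + (2 * M + 1) * b} ∪ G := fun ω hω => by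
      by_cases hωG : ω ∈ G
      · exact Or.inr hωG
      · obtain ⟨h1, h2, h3⟩ := hnG ω hωG
        have h4 := hlo ω h1 h2 h3
        have h5 := measureReal_Iio_le_of_le_quantile hα.1 hω
        have h6 := binomTail_le_add hb (S ω) (2 * M + 1)
        rw [← add_assoc] at h6
        push_cast at h6
        refine Or.inl ?_
        rw [mem_ofPred_eq]
        linarith
    have h1 := (measureReal_mono (μ := P) hsub).trans (measureReal_union_le _ _)
    have h2 := measureReal_binomTail_le hS (c := α + η + (2 * M + 1) * b)
      (by have := hα.1; positivity)
    nlinarith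
  · have hsub : {ω | binomTail θ n (S ω) < α - η - 2 * M * b} ⊆
        {ω | θ ≤ FIMA.quantile (q ω) α} ∪ G := fun ω hω => by
      rw [mem_ofPred_eq] at hω
      by_cases hωG : ω ∈ G
      · exact Or.inr hωG
      · obtain ⟨h1, h2, h3⟩ := hnG ω hωG
        have h4 := hup ω h1 h2 h3
        have h6 := binomTail_le_add hb (S ω - 2 * M) (2 * M)
        rw [Nat.sub_add_cancel (by omega)] at h6
        push_cast at h6
        exact Or.inl (le_quantile_of_lt hα.2 (by linarith))
    have h1 := (measureReal_mono (μ := P) hsub).trans (measureReal_union_le _ _)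
    have h2 := sub_le_measureReal_binomTail_lt hθ hS hb (c := α - η - 2 * M * b)
      (by have := hα.2; have : 0 ≤ 2 * M * b := by positivity
          linarith)
    nlinarith

end TailValue

/-! ### Noise tails, the sensitivity, and the limit for a general conditional law. -/

lemma tendsto_measureReal_abs_gt {ε : ℝ} (hε : 0 < ε) (ν : Measure ℝ) [IsProbabilityMeasure ν] :
    Tendsto (fun M : ℕ => ν.real {z | ε * M < |z|}) atTop (𝓝 0) := by
  have hanti : Antitone fun M : ℕ => {z : ℝ | ε * M < |z|} := fun M N h z hz => by
    rw [mem_ofPred_eq] at hz ⊢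
    refine lt_of_le_of_lt ?_ hz
    gcongr
  have h := tendsto_measure_iInter_atTop (μ := ν) (s := fun M : ℕ => {z : ℝ | ε * M < |z|})
    (fun M => (measurableSet_lt measurable_const (by fun_prop)).nullMeasurableSet) hanti
    ⟨0, measure_ne_top _ _⟩
  have he : ⋂ M : ℕ, {z : ℝ | ε * M < |z|} = ∅ := by
    refine eq_empty_of_forall_notMem fun z hz => ?_
    obtain ⟨M, hM⟩ := exists_nat_ge (|z| / ε)
    have := mem_iInter.1 hz M
    rw [div_le_iff₀ hε] at hM
    simp only [mem_ofPred_eq] at this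
    linarith
  rw [he, measure_empty] at h
  exact (ENNReal.tendsto_toReal ENNReal.zero_ne_top).comp h

lemma FIMA.sampleProp_eq {n : ℕ} (x : FIMA.Database n) :
    FIMA.sampleProp x = countMem {1} x / n := by
  rw [FIMA.sampleProp, Finset.sum_boole, one_div_mul_eq_div, countMem]
  simp

lemma FIMA.abs_sampleProp_sub {n : ℕ} {x y : FIMA.Database n} (h : hammingDist x y = 1) :
    |FIMA.sampleProp x - FIMA.sampleProp y| = 1 / n := by
  obtain ⟨i, hi⟩ := Finset.card_eq_one.1 h
  have hne : ∀ j, x j ≠ y j ↔ j = i := fun j => by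
    have := Finset.ext_iff.1 hi j
    simpa using this
  rw [FIMA.sampleProp, FIMA.sampleProp, ← mul_sub, ← Finset.sum_sub_distrib,
    Finset.sum_eq_single i]
  · have hxy := (hne i).2 rfl
    rw [abs_mul, abs_of_nonneg (by positivity)]
    have : |(if x i = 1 then (1 : ℝ) else 0) - (if y i = 1 then (1 : ℝ) else 0)| = 1 := by
      split_ifs with h1 h2 h2
      · exact absurd (h1.trans h2.symm) hxy
      · simp
      · simp
      · exact absurd (by omega) hxy
    rw [this, mul_one]
  · intro j _ hj
    have : x j = y j := not_not.1 fun h => hj ((hne j).1 h)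
    simp [this]
  · simp

lemma FIMA.sensitivity_eq {n : ℕ} (hn : 0 < n) : FIMA.sensitivity n = 1 / n := by
  have : {r : ℝ | ∃ x x' : FIMA.Database n, hammingDist x x' = 1 ∧
      r = |FIMA.sampleProp x - FIMA.sampleProp x'|} = {1 / (n : ℝ)} := by
    ext r
    constructor
    · rintro ⟨x, y, h, rfl⟩
      exact FIMA.abs_sampleProp_sub h
    · rintro rfl
      have h : hammingDist (0 : FIMA.Database n) (Function.update 0 ⟨0, hn⟩ 1) = 1 := by
        refine Finset.card_eq_one.2 ⟨⟨0, hn⟩, ?_⟩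
        ext j
        by_cases hj : j = ⟨0, hn⟩ <;> simp [hj]
      exact ⟨_, _, h, (FIMA.abs_sampleProp_sub h).symm⟩
  rw [FIMA.sensitivity, this, csSup_singleton]

/-- Common core of both versions: the conditional law `L` enters only through its two binomial-tail
bounds at θ. -/
theorem tendsto_coverage {θ : ℝ} (hθ : θ ∈ Ioo (0 : ℝ) 1) {α : ℝ} (hα : α ∈ Ioo (0 : ℝ) 1)
    {ε : ℝ} (hε : 0 < ε) (ν : Measure ℝ) [IsProbabilityMeasure ν]
    {Ω : ℕ → Type*} [∀ n, MeasurableSpace (Ω n)]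
    (P : ∀ n, Measure (Ω n)) [∀ n, IsProbabilityMeasure (P n)]
    (X : ∀ n, Fin n → Ω n → Fin 2) (hX : ∀ n i, Measurable (X n i))
    (hI : ∀ n, iIndepFun (X n) (P n)) (hXθ : ∀ n i, (P n).real {ω | X n i ω = 1} = θ)
    (Z : ∀ n, Ω n → ℝ) (hZ : ∀ n, HasLaw (Z n) ν (P n))
    (L : ℕ → ℝ → Measure ℝ) [∀ n p, IsProbabilityMeasure (L n p)]
    (hup : ∀ (M n s : ℕ) (z : ℝ), |z| ≤ ε * M → 2 * M + 2 ≤ s → s + 2 * M + 2 ≤ n →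
      (L n (s / n + 1 / n / ε * z)).real (Iic θ) ≤
        binomTail θ n (s - 2 * M) + ν.real {z | ε * M < |z|})
    (hlo : ∀ (M n s : ℕ) (z : ℝ), |z| ≤ ε * M → 2 * M + 2 ≤ s → s + 2 * M + 2 ≤ n →
      binomTail θ n (s + 2 * M + 1) ≤
        (L n (s / n + 1 / n / ε * z)).real (Iio θ) + ν.real {z | ε * M < |z|}) :
    Tendsto (fun n : ℕ => (P n).real {ω | θ ≤ FIMA.quantile
      (L n (FIMA.dpProp ε (fun i => X n i ω) (Z n ω))) α}) atTop (𝓝 α) := by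
  obtain ⟨b, hb, hbm⟩ := exists_tendsto_zero_binomMass_le hθ
  rw [Metric.tendsto_atTop']
  intro e he
  -- M depends on ν, ε and e only, making 2η < e/2; n is then taken large for this fixed M.
  obtain ⟨M, hM⟩ := ((tendsto_measureReal_abs_gt hε ν).eventually
    (gt_mem_nhds (show 0 < e / 4 by positivity))).exists
  have hb' : Tendsto (fun n => (6 * M + 6) * b n) atTop (𝓝 0) := by
    simpa using hb.const_mul (6 * (M : ℝ) + 6)
  obtain ⟨N, hN⟩ := eventually_atTop.1
    (hb'.eventually (gt_mem_nhds (show 0 < e / 2 by positivity)))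
  refine ⟨max N (2 * M + 1), fun n hn => ?_⟩
  have hnN := hN n ((le_max_left _ _).trans hn.le)
  have hnM : 2 * M + 1 ≤ n := (le_max_right _ _).trans hn.le
  have hn0 : 0 < n := by omega
  have hθ' := Ioo_subset_Icc_self hθ
  have hXθ' : ∀ i, (P n).real (X n i ⁻¹' {1}) = θ := hXθ n
  have hS := measureReal_le_countMem (hX n) (hI n) (measurableSet_singleton 1) hXθ'
  have hdp : ∀ ω, FIMA.dpProp ε (fun i => X n i ω) (Z n ω) =
      countMem {1} (fun i => X n i ω) / n +
        1 / n / ε * Z n ω := fun ω => by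
    rw [FIMA.dpProp, FIMA.sampleProp_eq, FIMA.privacyNoise, FIMA.sensitivity_eq hn0]
  have hA : (P n).real (Z n ⁻¹' {z | ε * M < |z|}) ≤ ν.real {z | ε * M < |z|} := by
    have hm : MeasurableSet {z : ℝ | ε * M < |z|} := measurableSet_lt measurable_const (by fun_prop)
    rw [← (hZ n).map_eq, measureReal_def, measureReal_def,
      Measure.map_apply_of_aemeasurable (hZ n).aemeasurable hm]
  have key := abs_coverage_sub_le hθ' (fun k => ?_) hS (hbm n) hα hnM hA
    (fun ω => L n (FIMA.dpProp ε (fun i => X n i ω) (Z n ω)))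
    (fun ω hω h1 h2 => by
      rw [hdp]; exact hup M n _ _ (not_lt.1 hω) h1 h2)
    (fun ω hω h1 h2 => by
      rw [hdp]; exact hlo M n _ _ (not_lt.1 hω) h1 h2)
  · rw [Real.dist_eq]
    linarith
  · exact measurable_countMem_comp (hX n) (measurableSet_singleton 1) measurableSet_Ici

/-! ### Version (a): interpolated uniform order statistics. -/

namespace FIMA

variable {n : ℕ} {δ : ℝ}

lemma orderStat_of_mem (δ : ℝ) (u : Fin n → ℝ) {k : ℕ} (hk : 1 ≤ k) (hkn : k ≤ n) :
    orderStat δ u k = (u ∘ Tuple.sort u) ⟨k - 1, by omega⟩ := by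
  rw [orderStat, if_neg (by omega), dif_pos (by omega)]
  rfl

lemma countMem_comp_perm {β : Type*} (B : Set β) (x : Fin n → β) (σ : Equiv.Perm (Fin n)) :
    countMem B (x ∘ σ) = countMem B x := by
  classical
  refine Finset.card_bij (fun i _ => σ i) (fun i hi => ?_) (fun i _ j _ h => σ.injective h)
    fun i hi => ⟨σ.symm i, ?_, σ.apply_symm_apply i⟩
  · simpa using hi
  · simpa using hi

/-- Duality between ranks and counts: it turns distribution functions of order statistics into
binomial tails, and also yields their measurability. -/
lemma orderStat_le_iff (u : Fin n → ℝ) {k : ℕ} (hk : 1 ≤ k) (hkn : k ≤ n) (v : ℝ) :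
    orderStat δ u k ≤ v ↔ k ≤ countMem (Iic v) u := by
  have h := Tuple.lt_card_le_iff_apply_le_of_monotone (j := ⟨k - 1, by omega⟩) (a := v)
    (Tuple.monotone_sort u)
  rw [orderStat_of_mem δ u hk hkn, ← h, ← countMem_comp_perm _ _ (Tuple.sort u), countMem]
  simp only [mem_Iic]
  constructor
  · intro h; convert Nat.succ_le_of_lt h using 1; omega
  · intro h; refine lt_of_lt_of_le (show k - 1 < k by omega) ?_; convert h

lemma orderStat_lt_iff (u : Fin n → ℝ) {k : ℕ} (hk : 1 ≤ k) (hkn : k ≤ n) (v : ℝ) :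
    orderStat δ u k < v ↔ k ≤ countMem (Iio v) u := by
  have h := Tuple.lt_card_lt_iff_apply_lt_of_monotone (j := ⟨k - 1, by omega⟩) (a := v)
    (Tuple.monotone_sort u)
  rw [orderStat_of_mem δ u hk hkn, ← h, ← countMem_comp_perm _ _ (Tuple.sort u), countMem]
  simp only [mem_Iio]
  constructor
  · intro h; convert Nat.succ_le_of_lt h using 1; omega
  · intro h; refine lt_of_lt_of_le (show k - 1 < k by omega) ?_; convert h

lemma measurable_orderStat (n : ℕ) (δ : ℝ) (k : ℕ) :
    Measurable fun u : Fin n → ℝ => orderStat δ u k := by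
  by_cases hk : 1 ≤ k ∧ k ≤ n
  · refine measurable_of_Iic fun v => ?_
    have : (fun u : Fin n → ℝ => orderStat δ u k) ⁻¹' Iic v = {u | k ≤ countMem (Iic v) u} := by
      ext u
      exact orderStat_le_iff u hk.1 hk.2 v
    rw [this]
    exact measurable_countMem measurableSet_Iic measurableSet_Ici
  · have : ∃ c, ∀ u : Fin n → ℝ, orderStat δ u k = c := by
      rcases Nat.eq_zero_or_pos k with h | h
      · exact ⟨δ, fun u => by rw [orderStat, if_pos h]⟩
      · exact ⟨1 - δ, fun u => by rw [orderStat, if_neg (by omega), dif_neg (by omega)]⟩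
    obtain ⟨c, hc⟩ := this
    simp_rw [hc]
    exact measurable_const

lemma measurable_draw (n : ℕ) (ε δ p : ℝ) :
    Measurable fun w : (ℝ × (Fin n → ℝ)) × ℝ => draw n ε δ p w.1.1 w.1.2 w.2 := by
  have ht : Measurable fun w : (ℝ × (Fin n → ℝ)) × ℝ => p - privacyNoise n ε w.1.1 := by
    unfold privacyNoise; fun_prop
  have ho : Measurable fun x : ℕ × (Fin n → ℝ) => orderStat δ x.2 x.1 :=
    measurable_from_prod_countable_right fun k => measurable_orderStat n δ k
  have hk : Measurable fun w : (ℝ × (Fin n → ℝ)) × ℝ =>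
      ⌊n * (p - privacyNoise n ε w.1.1)⌋₊ := Nat.measurable_floor.comp (ht.const_mul _)
  have h1 := ho.comp (hk.prodMk (measurable_snd.comp measurable_fst))
  have h2 := ho.comp ((hk.add_const 1).prodMk (measurable_snd.comp measurable_fst))
  exact Measurable.ite (measurableSet_lt measurable_const ht) measurable_const
    (Measurable.ite (measurableSet_lt ht measurable_const) measurable_const
      (h1.add (measurable_snd.mul (h2.sub h1))))

instance isProbabilityMeasure_restrict_Icc :
    IsProbabilityMeasure (volume.restrict (Icc (0 : ℝ) 1)) := ⟨by simp⟩

instance isProbabilityMeasure_drawLaw (n : ℕ) (ε δ : ℝ) (ν g : Measure ℝ)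
    [IsProbabilityMeasure ν] [IsProbabilityMeasure g] (p : ℝ) :
    IsProbabilityMeasure (drawLaw n ε δ ν g p) :=
  Measure.isProbabilityMeasure_map (measurable_draw n ε δ p).aemeasurable

/-- The law of a uniform sample of size `n`. -/
noncomputable abbrev uniformSample (n : ℕ) : Measure (Fin n → ℝ) :=
  Measure.pi fun _ : Fin n => volume.restrict (Icc (0 : ℝ) 1)

lemma uniformSample_le_countMem {B : Set ℝ} (hB : MeasurableSet B) {θ : ℝ}
    (hθ : (volume.restrict (Icc (0 : ℝ) 1)).real B = θ) (k : ℕ) :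
    (uniformSample n).real {u | k ≤ countMem B u} = binomTail θ n k := by
  have hI : iIndepFun (fun (i : Fin n) (u : Fin n → ℝ) => u i) (uniformSample n) :=
    iIndepFun_pi (X := fun _ => id) fun _ => aemeasurable_id
  refine measureReal_le_countMem (X := fun (i : Fin n) (u : Fin n → ℝ) => u i)
    (fun i => measurable_pi_apply i) hI hB (fun i => ?_) k
  rw [← hθ, measureReal_def, measureReal_def]
  congr 1
  exact (measurePreserving_eval (fun _ : Fin n => volume.restrict (Icc (0 : ℝ) 1)) i
    ).measure_preimage hB.nullMeasurableSet

lemma uniform_real_Iic {θ : ℝ} (hθ : θ ∈ Ioo (0 : ℝ) 1) :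
    (volume.restrict (Icc (0 : ℝ) 1)).real (Iic θ) = θ := by
  have : Iic θ ∩ Icc 0 1 = Icc 0 θ := by
    ext x; simp only [mem_inter_iff, mem_Iic, mem_Icc]
    constructor
    · rintro ⟨a, b, c⟩; exact ⟨b, a⟩
    · rintro ⟨a, b⟩; exact ⟨b, a, b.trans hθ.2.le⟩
  rw [measureReal_restrict_apply measurableSet_Iic, this, Real.volume_real_Icc_of_le hθ.1.le,
    sub_zero]

lemma uniform_real_Iio {θ : ℝ} (hθ : θ ∈ Ioo (0 : ℝ) 1) :
    (volume.restrict (Icc (0 : ℝ) 1)).real (Iio θ) = θ := by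
  rw [measureReal_congr (Iio_ae_eq_Iic (μ := volume.restrict (Icc (0 : ℝ) 1))),
    uniform_real_Iic hθ]

/-- The conditioned proportion `θ̃* = π̂ - Y*`, scaled by the sample size. -/
lemma mul_released_sub_noise {ε : ℝ} (hn : 0 < n) (s z z' : ℝ) :
    n * (s / n + 1 / n / ε * z - privacyNoise n ε z') = s + (z - z') / ε := by
  rw [privacyNoise, sensitivity_eq hn]
  field_simp
  ring

lemma abs_noise_sub_le {ε : ℝ} (hε : 0 < ε) {M : ℕ} {z z' : ℝ} (hz : |z| ≤ ε * M)
    (hz' : |z'| ≤ ε * M) : |(z - z') / ε| ≤ 2 * M := by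
  rw [abs_div, abs_of_pos hε, div_le_iff₀ hε]
  have := abs_sub z z'
  linarith

/-- The margin 2M + 2 at both ends keeps θ̃* in [0, 1] and makes k and k + 1 genuine ranks in 1, …,
n, so neither the clipping nor the conventions involving δ intervene. -/
lemma exists_draw_eq {ε : ℝ} (hε : 0 < ε) {M s : ℕ} {z z' : ℝ} (hz : |z| ≤ ε * M)
    (hz' : |z'| ≤ ε * M) (hs : 2 * M + 2 ≤ s) (hsn : s + 2 * M + 2 ≤ n) (δ : ℝ) :
    ∃ k : ℕ, s - 2 * M ≤ k ∧ k ≤ s + 2 * M ∧ ∀ (u : Fin n → ℝ) (d : ℝ),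
      draw n ε δ (s / n + 1 / n / ε * z) z' u d =
        orderStat δ u k + d * (orderStat δ u (k + 1) - orderStat δ u k) := by
  have hn : 0 < n := by omega
  have hn' : (0 : ℝ) < n := by exact_mod_cast hn
  set t := (s : ℝ) / n + 1 / n / ε * z - privacyNoise n ε z' with ht
  have hnt : n * t = s + (z - z') / ε := mul_released_sub_noise hn _ _ _
  obtain ⟨h1, h2⟩ := abs_le.1 (abs_noise_sub_le hε hz hz')
  have hs' : (2 * M + 2 : ℝ) ≤ s := by exact_mod_cast hs
  have hsn' : (s + 2 * M + 2 : ℝ) ≤ n := by exact_mod_cast hsn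
  have ht0 : 0 ≤ t := nonneg_of_mul_nonneg_right (by rw [hnt]; linarith) hn'
  have ht1 : t ≤ 1 := by
    refine le_of_mul_le_mul_left ?_ hn'
    rw [hnt]; linarith
  refine ⟨⌊n * t⌋₊, Nat.le_floor ?_, ?_, fun u d => ?_⟩
  · rw [hnt, Nat.cast_sub (by omega)]; push_cast; linarith
  · refine Nat.lt_succ_iff.1 ((Nat.floor_lt (by positivity)).2 ?_)
    rw [hnt]; push_cast; linarith
  · rw [draw, ← ht]
    simp only [not_lt.2 ht1, not_lt.2 ht0, if_false]

lemma orderStat_le_succ (u : Fin n → ℝ) {k : ℕ} (hk : 1 ≤ k) (hkn : k + 1 ≤ n) :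
    orderStat δ u k ≤ orderStat δ u (k + 1) := by
  rw [orderStat_of_mem δ u hk (by omega), orderStat_of_mem δ u (by omega) hkn]
  exact Tuple.monotone_sort u (by simp [Fin.le_def])

lemma measureReal_noise_prod (ν : Measure ℝ) [IsProbabilityMeasure ν] (g : Measure ℝ)
    [IsProbabilityMeasure g] (A : Set ℝ) (B : Set (Fin n → ℝ)) :
    ((ν.prod (uniformSample n)).prod g).real ((A ×ˢ B) ×ˢ univ) =
      ν.real A * (uniformSample n).real B := by
  rw [measureReal_prod_prod, measureReal_prod_prod, probReal_univ, mul_one]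

section

variable {θ ε : ℝ} {ν g : Measure ℝ} [IsProbabilityMeasure ν] [IsProbabilityMeasure g]

/-- As D ≥ 0, the draw is at least U_[k] with k ≥ s - 2M; a draw below θ thus forces at least s - 2M
uniforms below θ, unless the fresh noise is large. -/
lemma drawLaw_real_Iic_le (hθ : θ ∈ Ioo (0 : ℝ) 1) (hε : 0 < ε)
    (hg : ∀ᵐ d ∂g, d ∈ Icc (0 : ℝ) 1) {M s : ℕ} {z : ℝ} (hz : |z| ≤ ε * M)
    (hs : 2 * M + 2 ≤ s) (hsn : s + 2 * M + 2 ≤ n) :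
    (drawLaw n ε δ ν g (s / n + 1 / n / ε * z)).real (Iic θ) ≤
      binomTail θ n (s - 2 * M) + ν.real {z | ε * M < |z|} := by
  rw [drawLaw, map_measureReal_apply (measurable_draw n ε δ _) measurableSet_Iic]
  have hgw : ∀ᵐ w ∂((ν.prod (uniformSample n)).prod g), w.2 ∈ Icc (0 : ℝ) 1 :=
    Measure.quasiMeasurePreserving_snd.ae hg
  have hsub : ((fun w : (ℝ × (Fin n → ℝ)) × ℝ =>
      draw n ε δ (s / n + 1 / n / ε * z) w.1.1 w.1.2 w.2) ⁻¹' Iic θ : Set _) ≤ᵐ[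
        (ν.prod (uniformSample n)).prod g]
      ((univ ×ˢ {u | s - 2 * M ≤ countMem (Iic θ) u}) ×ˢ univ ∪
        ({z | ε * M < |z|} ×ˢ univ) ×ˢ univ : Set _) := by
    filter_upwards [hgw] with w hw hmem
    have hmem : draw n ε δ (s / n + 1 / n / ε * z) w.1.1 w.1.2 w.2 ≤ θ := hmem
    by_cases hz' : |w.1.1| ≤ ε * M
    · refine Or.inl ⟨⟨mem_univ _, ?_⟩, mem_univ _⟩
      obtain ⟨k, hk1, hk2, hk⟩ := exists_draw_eq (n := n) hε hz hz' hs hsn δ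
      rw [hk] at hmem
      have hle := orderStat_le_succ (δ := δ) w.1.2 (show 1 ≤ k by omega) (by omega)
      have : orderStat δ w.1.2 k ≤ θ := by
        nlinarith [mul_nonneg hw.1 (sub_nonneg.2 hle)]
      exact hk1.trans ((orderStat_le_iff _ (by omega) (by omega) _).1 this)
    · exact Or.inr ⟨⟨not_le.1 hz', mem_univ _⟩, mem_univ _⟩
  refine (ENNReal.toReal_mono (measure_ne_top _ _) (measure_mono_ae hsub)).trans
    ((measureReal_union_le _ _).trans ?_)
  rw [measureReal_noise_prod, measureReal_noise_prod, probReal_univ, probReal_univ, one_mul,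
    mul_one, uniformSample_le_countMem measurableSet_Iic (uniform_real_Iic hθ)]

/-- As D ≤ 1, the draw is at most U_[k+1], and k + 1 ≤ s + 2M + 1. -/
lemma le_drawLaw_real_Iio (hθ : θ ∈ Ioo (0 : ℝ) 1) (hε : 0 < ε)
    (hg : ∀ᵐ d ∂g, d ∈ Icc (0 : ℝ) 1) {M s : ℕ} {z : ℝ} (hz : |z| ≤ ε * M)
    (hs : 2 * M + 2 ≤ s) (hsn : s + 2 * M + 2 ≤ n) :
    binomTail θ n (s + 2 * M + 1) ≤
      (drawLaw n ε δ ν g (s / n + 1 / n / ε * z)).real (Iio θ) + ν.real {z | ε * M < |z|} := by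
  rw [drawLaw, map_measureReal_apply (measurable_draw n ε δ _) measurableSet_Iio]
  have hgw : ∀ᵐ w ∂((ν.prod (uniformSample n)).prod g), w.2 ∈ Icc (0 : ℝ) 1 :=
    Measure.quasiMeasurePreserving_snd.ae hg
  have hsub : ((univ ×ˢ {u | s + 2 * M + 1 ≤ countMem (Iio θ) u}) ×ˢ univ : Set _) ≤ᵐ[
        (ν.prod (uniformSample n)).prod g]
      (((fun w : (ℝ × (Fin n → ℝ)) × ℝ =>
      draw n ε δ (s / n + 1 / n / ε * z) w.1.1 w.1.2 w.2) ⁻¹' Iio θ) ∪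
        ({z | ε * M < |z|} ×ˢ univ) ×ˢ univ : Set _) := by
    filter_upwards [hgw] with w hw hmem
    have hmem : s + 2 * M + 1 ≤ countMem (Iio θ) w.1.2 := hmem.1.2
    by_cases hz' : |w.1.1| ≤ ε * M
    · refine Or.inl ?_
      obtain ⟨k, hk1, hk2, hk⟩ := exists_draw_eq (n := n) hε hz hz' hs hsn δ
      have hle := orderStat_le_succ (δ := δ) w.1.2 (show 1 ≤ k by omega) (by omega)
      have : orderStat δ w.1.2 (k + 1) < θ :=
        (orderStat_lt_iff _ (by omega) (by omega) _).2 (by omega)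
      rw [mem_preimage, hk, mem_Iio]
      nlinarith [mul_le_of_le_one_left (sub_nonneg.2 hle) hw.2]
    · exact Or.inr ⟨⟨not_le.1 hz', mem_univ _⟩, mem_univ _⟩
  have h := (ENNReal.toReal_mono (measure_ne_top _ _) (measure_mono_ae hsub)).trans
    (measureReal_union_le _ _)
  rw [← measureReal_def, measureReal_noise_prod, measureReal_noise_prod, probReal_univ,
    probReal_univ, one_mul, mul_one,
    uniformSample_le_countMem measurableSet_Iio (uniform_real_Iio hθ)] at h
  exact h

end

end FIMA

/-! ### Beta distribution functions and binomial tails. -/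

section BinomDeriv

/-- The derivatives of the atoms telescope, so the induction descends from the empty tail. Truncated
exponents (k = 0 or k = n) always carry a zero factor. -/
lemma hasDerivAt_binomTail (n k : ℕ) (hk : k ≤ n + 1) (x : ℝ) :
    HasDerivAt (fun y => binomTail y n k) (k * n.choose k * x ^ (k - 1) * (1 - x) ^ (n - k)) x := by
  induction hk using Nat.decreasingInduction with
  | self =>
    have : (fun y => binomTail y n (n + 1)) = fun _ => 0 :=
      funext fun y => binomTail_of_lt y (Nat.lt_succ_self n)
    rw [this, Nat.choose_eq_zero_of_lt (Nat.lt_succ_self n)]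
    simpa using hasDerivAt_const x (0 : ℝ)
  | of_succ k hk ih =>
    have h1 : HasDerivAt (fun y : ℝ => binomMass y n k)
        (n.choose k * (k * x ^ (k - 1)) * (1 - x) ^ (n - k) +
          n.choose k * x ^ k * ((n - k : ℕ) * (1 - x) ^ (n - k - 1) * (-1))) x :=
      ((hasDerivAt_pow k x).const_mul _).mul (((hasDerivAt_id x).const_sub 1).pow (n - k))
    have h2 : (fun y => binomTail y n k) = fun y => binomMass y n k + binomTail y n (k + 1) :=
      funext fun y => binomTail_eq_add y n k
    rw [h2]
    have h3 : ((k + 1 : ℕ) : ℝ) * n.choose (k + 1) = n.choose k * (n - k : ℕ) := by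
      exact_mod_cast (mul_comm _ _).trans (Nat.choose_succ_right_eq n k)
    refine (h1.add ih).congr_deriv ?_
    rw [h3, Nat.add_sub_cancel, Nat.sub_sub]
    ring

lemma binomTail_zero_left {n k : ℕ} (hk : 1 ≤ k) : binomTail 0 n k = 0 :=
  Finset.sum_eq_zero fun j hj => by
    have := (Finset.mem_Icc.1 hj).1
    simp [binomMass, show j ≠ 0 by omega]

lemma binomTail_one_left {n k : ℕ} (hk : k ≤ n) : binomTail 1 n k = 1 := by
  rw [binomTail, Finset.sum_eq_single n]
  · simp [binomMass]
  · intro j hj hjn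
    have := (Finset.mem_Icc.1 hj).2
    simp [binomMass, show n - j ≠ 0 by omega]
  · intro h; exact absurd (Finset.mem_Icc.2 ⟨hk, le_rfl⟩) h

end BinomDeriv

section BetaCDF

/-- The unnormalized density of the `Beta(a, n + 1 - a)` distribution. -/
noncomputable def betaWeight (n : ℕ) (a x : ℝ) : ℝ := x ^ (a - 1) * (1 - x) ^ (n - a)

variable {n : ℕ} {a a' θ : ℝ}

lemma continuous_betaWeight (ha : 1 ≤ a) (han : a ≤ n) : Continuous (betaWeight n a) :=
  (continuous_id.rpow_const fun _ => Or.inr (sub_nonneg.2 ha)).mul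
    ((continuous_const.sub continuous_id).rpow_const fun _ => Or.inr (sub_nonneg.2 han))

lemma betaWeight_nonneg {x : ℝ} (hx : x ∈ Icc (0 : ℝ) 1) : 0 ≤ betaWeight n a x :=
  mul_nonneg (Real.rpow_nonneg hx.1 _) (Real.rpow_nonneg (sub_nonneg.2 hx.2) _)

lemma integral_betaWeight_pos (ha : 1 ≤ a) (han : a ≤ n) {l r : ℝ} (hl : 0 ≤ l) (hlr : l < r)
    (hr : r ≤ 1) : 0 < ∫ x in l..r, betaWeight n a x :=
  intervalIntegral.intervalIntegral_pos_of_pos_on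
    ((continuous_betaWeight ha han).intervalIntegrable _ _)
    (fun _ hx => mul_pos (Real.rpow_pos_of_pos (hl.trans_lt hx.1) _)
      (Real.rpow_pos_of_pos (sub_pos.2 (hx.2.trans_le hr)) _)) hlr

lemma betaWeight_eq_mul (ha : 1 ≤ a) (haa : a ≤ a') (han : a' ≤ n) {x : ℝ}
    (hx : x ∈ Icc (0 : ℝ) 1) :
    betaWeight n a' x = x ^ (a' - a) * (x ^ (a - 1) * (1 - x) ^ (n - a')) ∧
    betaWeight n a x = (1 - x) ^ (a' - a) * (x ^ (a - 1) * (1 - x) ^ (n - a')) := by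
  have hd := sub_nonneg.2 haa
  constructor
  · rw [betaWeight, show a' - 1 = (a' - a) + (a - 1) by ring,
      Real.rpow_add_of_nonneg hx.1 hd (sub_nonneg.2 ha), mul_assoc]
  · rw [betaWeight, show n - a = (a' - a) + (n - a') by ring,
      Real.rpow_add_of_nonneg (sub_nonneg.2 hx.2) hd (sub_nonneg.2 han)]
    ring

/-- The beta distributions with fixed parameter sum are stochastically increasing in the first
parameter. -/
lemma betaWeight_integral_div_anti (hθ : θ ∈ Ioo (0 : ℝ) 1) (ha : 1 ≤ a) (haa : a ≤ a')
    (han : a' ≤ n) :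
    (∫ x in (0 : ℝ)..θ, betaWeight n a' x) / (∫ x in (0 : ℝ)..1, betaWeight n a' x) ≤
      (∫ x in (0 : ℝ)..θ, betaWeight n a x) / (∫ x in (0 : ℝ)..1, betaWeight n a x) := by
  have hθ1 := sub_pos.2 hθ.2
  have hd := sub_nonneg.2 haa
  have hi : ∀ l r, IntervalIntegrable (betaWeight n a) volume l r :=
    (continuous_betaWeight ha (haa.trans han)).intervalIntegrable
  have hi' : ∀ l r, IntervalIntegrable (betaWeight n a') volume l r :=
    (continuous_betaWeight (ha.trans haa) han).intervalIntegrable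
  -- Monotone likelihood ratio: the weights for a' and a have ratio (x/(1 - x))^(a' - a), increasing
  -- in x. Comparing it with its value at θ gives `h1` on [0, θ] and `h2` on [θ, 1], stated without
  -- division to include the endpoints.
  have h1 : (1 - θ) ^ (a' - a) * ∫ x in (0 : ℝ)..θ, betaWeight n a' x ≤
      θ ^ (a' - a) * ∫ x in (0 : ℝ)..θ, betaWeight n a x := by
    rw [← intervalIntegral.integral_const_mul, ← intervalIntegral.integral_const_mul]
    refine intervalIntegral.integral_mono_on hθ.1.le ((hi' _ _).const_mul _)
      ((hi _ _).const_mul _) fun x hx => ?_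
    have hx1 : x ∈ Icc (0 : ℝ) 1 := ⟨hx.1, hx.2.trans hθ.2.le⟩
    obtain ⟨e1, e2⟩ := betaWeight_eq_mul ha haa han hx1
    have hc : 0 ≤ x ^ (a - 1) * (1 - x) ^ (n - a') :=
      mul_nonneg (Real.rpow_nonneg hx1.1 _) (Real.rpow_nonneg (sub_nonneg.2 hx1.2) _)
    rw [e1, e2]
    have := mul_le_mul_of_nonneg_right (mul_le_mul (Real.rpow_le_rpow hx.1 hx.2 hd)
      (Real.rpow_le_rpow hθ1.le (sub_le_sub_left hx.2 1) hd) (Real.rpow_nonneg hθ1.le _)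
      (Real.rpow_nonneg hθ.1.le _)) hc
    linarith
  have h2 : θ ^ (a' - a) * ∫ x in θ..1, betaWeight n a x ≤
      (1 - θ) ^ (a' - a) * ∫ x in θ..1, betaWeight n a' x := by
    rw [← intervalIntegral.integral_const_mul, ← intervalIntegral.integral_const_mul]
    refine intervalIntegral.integral_mono_on hθ.2.le ((hi _ _).const_mul _)
      ((hi' _ _).const_mul _) fun x hx => ?_
    have hx1 : x ∈ Icc (0 : ℝ) 1 := ⟨hθ.1.le.trans hx.1, hx.2⟩
    obtain ⟨e1, e2⟩ := betaWeight_eq_mul ha haa han hx1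
    have hc : 0 ≤ x ^ (a - 1) * (1 - x) ^ (n - a') :=
      mul_nonneg (Real.rpow_nonneg hx1.1 _) (Real.rpow_nonneg (sub_nonneg.2 hx1.2) _)
    rw [e1, e2]
    have := mul_le_mul_of_nonneg_right (mul_le_mul (Real.rpow_le_rpow hθ.1.le hx.1 hd)
      (Real.rpow_le_rpow (sub_nonneg.2 hx.2) (sub_le_sub_left hx.1 1) hd)
      (Real.rpow_nonneg (sub_nonneg.2 hx.2) _) (Real.rpow_nonneg hx1.1 _)) hc
    linarith
  rw [← intervalIntegral.integral_add_adjacent_intervals (hi 0 θ) (hi θ 1),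
    ← intervalIntegral.integral_add_adjacent_intervals (hi' 0 θ) (hi' θ 1)]
  have p1 := integral_betaWeight_pos ha (haa.trans han) le_rfl hθ.1 hθ.2.le
  have p2 := integral_betaWeight_pos ha (haa.trans han) hθ.1.le hθ.2 le_rfl
  have p3 := integral_betaWeight_pos (ha.trans haa) han le_rfl hθ.1 hθ.2.le
  have p4 := integral_betaWeight_pos (ha.trans haa) han hθ.1.le hθ.2 le_rfl
  set A := ∫ x in (0 : ℝ)..θ, betaWeight n a x
  set B := ∫ x in θ..1, betaWeight n a x
  set A' := ∫ x in (0 : ℝ)..θ, betaWeight n a' x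
  set B' := ∫ x in θ..1, betaWeight n a' x
  have hpos : 0 < (1 - θ) ^ (a' - a) := Real.rpow_pos_of_pos hθ1 _
  have h3 : A' * B ≤ A * B' := by
    refine le_of_mul_le_mul_left ?_ hpos
    nlinarith [mul_le_mul_of_nonneg_right h1 p2.le, mul_le_mul_of_nonneg_left h2 p1.le]
  rw [div_le_div_iff₀ (add_pos p3 p4) (add_pos p1 p2)]
  linarith

/-- Fundamental theorem of calculus: the tail vanishes at 0 and its derivative is a multiple of the
weight. Taking x = 1 gives the normalising constant. -/
lemma integral_betaWeight_nat {k : ℕ} (hk : 1 ≤ k) (hkn : k ≤ n) (x : ℝ) :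
    k * n.choose k * ∫ y in (0 : ℝ)..x, betaWeight n k y = binomTail x n k := by
  have h := intervalIntegral.integral_eq_sub_of_hasDerivAt (a := 0) (b := x)
    (fun y _ => hasDerivAt_binomTail n k (by omega) y)
    (Continuous.intervalIntegrable (by fun_prop) _ _)
  rw [binomTail_zero_left hk, sub_zero] at h
  rw [← h, ← intervalIntegral.integral_const_mul]
  refine intervalIntegral.integral_congr fun y _ => ?_
  have e1 : (k : ℝ) - 1 = (k - 1 : ℕ) := by push_cast [Nat.cast_sub hk]; rfl
  have e2 : (n : ℝ) - k = (n - k : ℕ) := by rw [Nat.cast_sub hkn]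
  simp only [betaWeight]
  rw [e1, e2, Real.rpow_natCast, Real.rpow_natCast]
  ring

lemma integral_betaWeight_nat_div {k : ℕ} (hk : 1 ≤ k) (hkn : k ≤ n) (x : ℝ) :
    (∫ y in (0 : ℝ)..x, betaWeight n k y) / (∫ y in (0 : ℝ)..1, betaWeight n k y) =
      binomTail x n k := by
  have h1 := integral_betaWeight_nat hk hkn 1
  rw [binomTail_one_left hkn] at h1
  have hne : ∫ y in (0 : ℝ)..1, betaWeight n k y ≠ 0 := fun h => by simp [h] at h1
  rw [div_eq_iff hne, ← integral_betaWeight_nat hk hkn x]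
  linear_combination (-∫ y in (0 : ℝ)..x, betaWeight n k y) * h1

lemma betaMeasure_real_Iic_eq_mul (ha : 1 ≤ a) (han : a ≤ n) {x : ℝ} (hx : x ∈ Icc (0 : ℝ) 1) :
    (betaMeasure a (n + 1 - a)).real (Iic x) =
      1 / beta a (n + 1 - a) * ∫ y in (0 : ℝ)..x, betaWeight n a y := by
  have hb : 0 < 1 / beta a (n + 1 - a) := one_div_pos.2 (beta_pos (by linarith) (by linarith))
  have hc := (continuous_betaWeight ha han).const_mul (1 / beta a (n + 1 - a))
  rw [measureReal_def, betaMeasure, withDensity_apply _ measurableSet_Iic,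
    ← lintegral_indicator measurableSet_Iic]
  have hae : (Iic x).indicator (betaPDF a (n + 1 - a)) =ᵐ[volume] (Ioc 0 x).indicator
      fun y => ENNReal.ofReal (1 / beta a (n + 1 - a) * betaWeight n a y) := by
    -- At y = 1 the density is 0, but the weight is 0^0 = 1 when a = n.
    have : ∀ᵐ y : ℝ, y ≠ 1 := by simp [ae_iff]
    filter_upwards [this] with y hy
    by_cases hyx : y ≤ x
    · rcases le_or_gt y 0 with h0 | h0
      · rw [indicator_of_mem (show y ∈ Iic x from hyx), betaPDF_eq_zero_of_nonpos h0,
          indicator_of_notMem (fun h => not_lt.2 h0 h.1)]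
      · rw [indicator_of_mem (show y ∈ Iic x from hyx), indicator_of_mem (show y ∈ Ioc 0 x from
          ⟨h0, hyx⟩), betaPDF_of_pos_lt_one h0 (lt_of_le_of_ne (hyx.trans hx.2) hy), betaWeight,
          mul_assoc, show (n : ℝ) + 1 - a - 1 = n - a by ring]
    · rw [indicator_of_notMem (show y ∉ Iic x from hyx), indicator_of_notMem fun h => hyx h.2]
  rw [lintegral_congr_ae hae, lintegral_indicator measurableSet_Ioc,
    ← ofReal_integral_eq_lintegral_ofReal (hc.integrableOn_Ioc), ENNReal.toReal_ofReal,
    integral_const_mul, intervalIntegral.integral_of_le hx.1]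
  · refine integral_nonneg_of_ae ((ae_restrict_iff' measurableSet_Ioc).2 (ae_of_all _ ?_))
    exact fun y hy => mul_nonneg hb.le (betaWeight_nonneg ⟨hy.1.le, hy.2.trans hx.2⟩)
  · refine (ae_restrict_iff' measurableSet_Ioc).2 (ae_of_all _ ?_)
    exact fun y hy => mul_nonneg hb.le (betaWeight_nonneg ⟨hy.1.le, hy.2.trans hx.2⟩)

lemma betaMeasure_ae_eq {s t : Set ℝ} (p q : ℝ) (h : s =ᵐ[volume] t) :
    (betaMeasure p q).real s = (betaMeasure p q).real t :=
  measureReal_congr ((withDensity_absolutelyContinuous _ _).ae_eq h)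

lemma betaMeasure_real_Iic (ha : 1 ≤ a) (han : a ≤ n) {x : ℝ} (hx : x ∈ Icc (0 : ℝ) 1) :
    (betaMeasure a (n + 1 - a)).real (Iic x) =
      (∫ y in (0 : ℝ)..x, betaWeight n a y) / ∫ y in (0 : ℝ)..1, betaWeight n a y := by
  have hbp : 0 < beta a (n + 1 - a) := beta_pos (by linarith) (by linarith)
  have hP : IsProbabilityMeasure (betaMeasure a (n + 1 - a)) :=
    isProbabilityMeasureBeta (by linarith) (by linarith)
  have h1 : (betaMeasure a (n + 1 - a)).real (Iic 1) = 1 := by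
    refine Eq.trans ?_ (probReal_univ (μ := betaMeasure a (n + 1 - a)))
    rw [measureReal_def, measureReal_def]
    congr 1
    rw [betaMeasure, withDensity_apply _ measurableSet_Iic, withDensity_apply _ .univ,
      setLIntegral_univ, ← lintegral_indicator measurableSet_Iic]
    refine lintegral_congr fun y => ?_
    by_cases hy : y ≤ 1
    · rw [indicator_of_mem (show y ∈ Iic (1 : ℝ) from hy)]
    · rw [indicator_of_notMem (show y ∉ Iic (1 : ℝ) from hy),
        betaPDF_eq_zero_of_one_le (not_le.1 hy).le]
  rw [betaMeasure_real_Iic_eq_mul ha han ⟨zero_le_one, le_rfl⟩] at h1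
  rw [betaMeasure_real_Iic_eq_mul ha han hx]
  have hne : ∫ y in (0 : ℝ)..1, betaWeight n a y ≠ 0 := fun h => by simp [h] at h1
  rw [eq_div_iff hne]
  linear_combination (∫ y in (0 : ℝ)..x, betaWeight n a y) * h1

/-- Stochastic monotonicity replaces a real parameter by an integer one, where the distribution
function is a binomial tail. -/
lemma betaMeasure_real_Iic_le {k : ℕ} (hθ : θ ∈ Ioo (0 : ℝ) 1) (hk : 1 ≤ k) (hka : k ≤ a)
    (han : a ≤ n) : (betaMeasure a (n + 1 - a)).real (Iic θ) ≤ binomTail θ n k := by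
  have hk' : (1 : ℝ) ≤ k := by exact_mod_cast hk
  rw [betaMeasure_real_Iic (hk'.trans hka) han (Ioo_subset_Icc_self hθ),
    ← integral_betaWeight_nat_div hk (by exact_mod_cast hka.trans han)]
  exact betaWeight_integral_div_anti hθ hk' hka han

lemma le_betaMeasure_real_Iio {k : ℕ} (hθ : θ ∈ Ioo (0 : ℝ) 1) (ha : 1 ≤ a) (hak : a ≤ k)
    (hkn : k ≤ n) : binomTail θ n k ≤ (betaMeasure a (n + 1 - a)).real (Iio θ) := by
  have hkn' : (k : ℝ) ≤ n := by exact_mod_cast hkn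
  rw [betaMeasure_ae_eq _ _ Iio_ae_eq_Iic,
    betaMeasure_real_Iic ha (hak.trans hkn') (Ioo_subset_Icc_self hθ),
    ← integral_betaWeight_nat_div (by exact_mod_cast ha.trans hak) hkn]
  exact betaWeight_integral_div_anti hθ ha hak hkn'

end BetaCDF

/-- Needed for joint measurability of the beta densities, hence for evaluating `Measure.bind` in
`betaLaw`. -/
lemma Real.measurable_Gamma : Measurable Real.Gamma := by
  refine measurable_of_tendsto_metrizable (f := fun n s => Real.GammaSeq s n) (fun n => ?_)
    (tendsto_pi_nhds.2 fun s => Real.GammaSeq_tendsto_Gamma s)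
  unfold Real.GammaSeq
  fun_prop

lemma measurable_betaMeasure : Measurable fun p : ℝ × ℝ => betaMeasure p.1 p.2 := by
  have hG := Real.measurable_Gamma
  refine Measure.measurable_of_measurable_coe _ fun s hs => ?_
  simp_rw [betaMeasure, withDensity_apply _ hs]
  refine Measurable.lintegral_prod_right' (f := fun q : (ℝ × ℝ) × ℝ => betaPDF q.1.1 q.1.2 q.2) ?_
  unfold betaPDF betaPDFReal beta
  refine ENNReal.measurable_ofReal.comp (Measurable.ite ?_ ?_ measurable_const)
  · exact (measurableSet_lt measurable_const measurable_snd).inter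
      (measurableSet_lt measurable_snd measurable_const)
  · fun_prop

/-! ### Version (b): the Beta step. -/

namespace FIMA

lemma measurable_betaStep (n : ℕ) (δ : ℝ) : Measurable (betaStep n δ) :=
  Measurable.ite measurableSet_Ioi measurable_const
    (Measurable.ite measurableSet_Iio measurable_const
      (measurable_betaMeasure.comp (f := fun t : ℝ => ((n * t + 1 / 2 : ℝ), (n - n * t + 1 / 2 : ℝ)))
        (by fun_prop)))

lemma measurable_betaStep_noise (n : ℕ) (ε δ p : ℝ) :
    Measurable fun z => betaStep n δ (p - privacyNoise n ε z) :=
  (measurable_betaStep n δ).comp (by unfold privacyNoise; fun_prop)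

instance isProbabilityMeasure_betaStep (n : ℕ) (δ t : ℝ) :
    IsProbabilityMeasure (betaStep n δ t) := by
  unfold betaStep
  split_ifs with h1 h0
  · infer_instance
  · infer_instance
  · have : 0 ≤ n * t := mul_nonneg n.cast_nonneg (not_lt.1 h0)
    have : n * t ≤ n := mul_le_of_le_one_right n.cast_nonneg (not_lt.1 h1)
    exact isProbabilityMeasureBeta (by linarith) (by linarith)

instance isProbabilityMeasure_betaLaw (n : ℕ) (ε δ : ℝ) (ν : Measure ℝ) [IsProbabilityMeasure ν]
    (p : ℝ) : IsProbabilityMeasure (betaLaw n ε δ ν p) := by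
  constructor
  rw [betaLaw, Measure.bind_apply .univ (measurable_betaStep_noise n ε δ p).aemeasurable]
  simp

variable {n : ℕ} {δ θ ε : ℝ}

/-- The first parameter a = n θ̃* + 1/2 lies within 2M of s + 1/2, hence between the integers s - 2M
and s + 2M + 1; the second is n + 1 - a. -/
lemma betaStep_bounds (hθ : θ ∈ Ioo (0 : ℝ) 1) (hε : 0 < ε) {M s : ℕ} {z z' : ℝ}
    (hz : |z| ≤ ε * M) (hz' : |z'| ≤ ε * M) (hs : 2 * M + 2 ≤ s) (hsn : s + 2 * M + 2 ≤ n) :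
    (betaStep n δ (s / n + 1 / n / ε * z - privacyNoise n ε z')).real (Iic θ) ≤
      binomTail θ n (s - 2 * M) ∧
    binomTail θ n (s + 2 * M + 1) ≤
      (betaStep n δ (s / n + 1 / n / ε * z - privacyNoise n ε z')).real (Iio θ) := by
  have hn : 0 < n := by omega
  have hn' : (0 : ℝ) < n := by exact_mod_cast hn
  set t := (s : ℝ) / n + 1 / n / ε * z - privacyNoise n ε z' with ht
  have hnt : n * t = s + (z - z') / ε := mul_released_sub_noise hn _ _ _
  obtain ⟨h1, h2⟩ := abs_le.1 (abs_noise_sub_le hε hz hz')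
  have hs' : (2 * M + 2 : ℝ) ≤ s := by exact_mod_cast hs
  have hsn' : (s + 2 * M + 2 : ℝ) ≤ n := by exact_mod_cast hsn
  have ht0 : 0 ≤ t := nonneg_of_mul_nonneg_right (by rw [hnt]; linarith) hn'
  have ht1 : t ≤ 1 := by
    refine le_of_mul_le_mul_left ?_ hn'
    rw [hnt]; linarith
  rw [betaStep, if_neg (not_lt.2 ht1), if_neg (not_lt.2 ht0),
    show n - n * t + 1 / 2 = n + 1 - (n * t + 1 / 2) by ring, hnt]
  constructor
  · refine betaMeasure_real_Iic_le hθ (by omega) ?_ (by linarith)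
    rw [Nat.cast_sub (by omega)]; push_cast; linarith
  · refine le_betaMeasure_real_Iio hθ (by linarith) ?_ (by omega)
    push_cast; linarith

variable {ν : Measure ℝ} [IsProbabilityMeasure ν]

lemma measurableSet_abs_gt (c : ℝ) : MeasurableSet {z : ℝ | c < |z|} :=
  measurableSet_lt measurable_const (by fun_prop)

lemma betaLaw_real_Iic_le (hθ : θ ∈ Ioo (0 : ℝ) 1) (hε : 0 < ε) {M s : ℕ} {z : ℝ}
    (hz : |z| ≤ ε * M) (hs : 2 * M + 2 ≤ s) (hsn : s + 2 * M + 2 ≤ n) :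
    (betaLaw n ε δ ν (s / n + 1 / n / ε * z)).real (Iic θ) ≤
      binomTail θ n (s - 2 * M) + ν.real {z | ε * M < |z|} := by
  have hb : 0 ≤ binomTail θ n (s - 2 * M) :=
    Finset.sum_nonneg fun j _ => binomMass_nonneg (Ioo_subset_Icc_self hθ) n j
  rw [measureReal_def, betaLaw, Measure.bind_apply measurableSet_Iic
    (measurable_betaStep_noise n ε δ _).aemeasurable]
  refine ENNReal.toReal_le_of_le_ofReal (add_nonneg hb measureReal_nonneg) ?_
  rw [ENNReal.ofReal_add hb measureReal_nonneg, ofReal_measureReal]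
  -- For large fresh noise the conditional probability is bounded by 1, which the indicator pays
  -- for.
  calc _ ≤ ∫⁻ z', ENNReal.ofReal (binomTail θ n (s - 2 * M)) +
        {z | ε * M < |z|}.indicator 1 z' ∂ν := lintegral_mono fun z' => ?_
    _ = _ := by
      rw [lintegral_add_left measurable_const, lintegral_const, measure_univ, mul_one,
        lintegral_indicator_one (measurableSet_abs_gt _)]
  by_cases hz' : |z'| ≤ ε * M
  · refine le_add_right ?_
    rw [← ofReal_measureReal]
    exact ENNReal.ofReal_le_ofReal (betaStep_bounds hθ hε hz hz' hs hsn).1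
  · rw [indicator_of_mem (show z' ∈ {z | ε * M < |z|} from not_le.1 hz'), Pi.one_apply]
    exact le_add_left prob_le_one

lemma le_betaLaw_real_Iio (hθ : θ ∈ Ioo (0 : ℝ) 1) (hε : 0 < ε) {M s : ℕ} {z : ℝ}
    (hz : |z| ≤ ε * M) (hs : 2 * M + 2 ≤ s) (hsn : s + 2 * M + 2 ≤ n) :
    binomTail θ n (s + 2 * M + 1) ≤
      (betaLaw n ε δ ν (s / n + 1 / n / ε * z)).real (Iio θ) + ν.real {z | ε * M < |z|} := by
  have hb1 : binomTail θ n (s + 2 * M + 1) ≤ 1 := by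
    rw [← binomTail_zero θ n]
    exact binomTail_antitone (Ioo_subset_Icc_self hθ) n (Nat.zero_le _)
  rw [← ENNReal.ofReal_le_ofReal_iff (add_nonneg measureReal_nonneg measureReal_nonneg),
    ENNReal.ofReal_add measureReal_nonneg measureReal_nonneg, ofReal_measureReal,
    ofReal_measureReal, betaLaw, Measure.bind_apply measurableSet_Iio
    (measurable_betaStep_noise n ε δ _).aemeasurable]
  calc _ = ∫⁻ _, ENNReal.ofReal (binomTail θ n (s + 2 * M + 1)) ∂ν := by
        rw [lintegral_const, measure_univ, mul_one]
    _ ≤ ∫⁻ z', betaStep n δ (s / n + 1 / n / ε * z - privacyNoise n ε z') (Iio θ) +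
        {z | ε * M < |z|}.indicator 1 z' ∂ν := lintegral_mono fun z' => ?_
    _ = _ := by
      rw [lintegral_add_right _ (measurable_one.indicator (measurableSet_abs_gt _)),
        lintegral_indicator_one (measurableSet_abs_gt _)]
  by_cases hz' : |z'| ≤ ε * M
  · refine le_add_right ?_
    rw [← ofReal_measureReal]
    exact ENNReal.ofReal_le_ofReal (betaStep_bounds hθ hε hz hz' hs hsn).2
  · rw [indicator_of_mem (show z' ∈ {z | ε * M < |z|} from not_le.1 hz'), Pi.one_apply]
    exact le_add_left (ENNReal.ofReal_le_one.2 hb1)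

end FIMA

theorem theorem1
    (θ₀ : ℝ) (hθ₀ : θ₀ ∈ Ioo (0 : ℝ) 1)
    (α : ℝ) (hα : α ∈ Ioo (0 : ℝ) 1)
    (ε : ℝ) (hε : 0 < ε)
    (δ : ℝ) (hδ : δ ∈ Ioo (0 : ℝ) 1)
    -- the law of the noise variable: zero mean and finite variance
    (ν : Measure ℝ) [IsProbabilityMeasure ν]
    (hν_var : MemLp (fun z : ℝ => z) 2 ν) (hν_mean : ∫ z, z ∂ν = 0)
    -- for every `n`, a sample of size `n` and a noise variable independent of it
    {Ω : ℕ → Type*} [∀ n, MeasurableSpace (Ω n)]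
    (P : ∀ n, Measure (Ω n)) [∀ n, IsProbabilityMeasure (P n)]
    (X : ∀ n, Fin n → Ω n → Fin 2) (hX_meas : ∀ n i, Measurable (X n i))
    (hX_indep : ∀ n, iIndepFun (X n) (P n))
    (hX_law : ∀ n i, (P n).real {ω | X n i ω = 1} = θ₀)
    (Z : ∀ n, Ω n → ℝ) (hZ_law : ∀ n, HasLaw (Z n) ν (P n))
    (hXZ : ∀ n, IndepFun (fun ω i => X n i ω) (Z n) (P n)) :
    -- the algorithm, with any distribution of the interpolation variable on `[0, 1]`
    (∀ (g : Measure ℝ) [IsProbabilityMeasure g], (∀ᵐ d ∂g, d ∈ Icc (0 : ℝ) 1) →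
      Tendsto (fun n : ℕ => (P n).real {ω | θ₀ ≤ FIMA.quantile
        (FIMA.drawLaw n ε δ ν g (FIMA.dpProp ε (fun i => X n i ω) (Z n ω))) α})
        atTop (𝓝 α)) ∧
    -- the Beta version
    Tendsto (fun n : ℕ => (P n).real {ω | θ₀ ≤ FIMA.quantile
      (FIMA.betaLaw n ε δ ν (FIMA.dpProp ε (fun i => X n i ω) (Z n ω))) α})
      atTop (𝓝 α) := by
  constructor
  · intro g _ hg
    exact tendsto_coverage hθ₀ hα hε ν P X hX_meas hX_indep hX_law Z hZ_law
      (fun n p => FIMA.drawLaw n ε δ ν g p)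
      (fun _ _ _ _ hz hs hsn => FIMA.drawLaw_real_Iic_le hθ₀ hε hg hz hs hsn)
      (fun _ _ _ _ hz hs hsn => FIMA.le_drawLaw_real_Iio hθ₀ hε hg hz hs hsn)
  · exact tendsto_coverage hθ₀ hα hε ν P X hX_meas hX_indep hX_law Z hZ_law
      (fun n p => FIMA.betaLaw n ε δ ν p)
      (fun _ _ _ _ hz hs hsn => FIMA.betaLaw_real_Iic_le hθ₀ hε hz hs hsn)
      (fun _ _ _ _ hz hs hsn => FIMA.le_betaLaw_real_Iio hθ₀ hε hz hs hsn)
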